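/- Let $V$ be a finite-dimensional simple Euclidean Jordan algebra over $\mathbb{R}$ with unit $e$, dimension $n$ and rank $r$, and fix a Jordan frame $c_1,\dots,c_r$ of $V$. Let $d$ be the common dimension of the Peirce spaces $V_{jk}=\{x\in V: c_jx=c_kx=\tfrac12x\}$, $j<k$ (if $r=1$, $d$ plays no role). Let $\Omega$ be the interior of the set of squares of $V$, $G$ the identity component of $\{g\in GL(V): g\Omega=\Omega\}$, and $K$ the identity component of $\mathrm{Aut}(V)$. For $j=1,\dots,r$ let $\Delta_j(x)=\delta_j(P_jx)$, where $P_j$ is the orthogonal projection of $V$ onto the subalgebra $V^{(j)}=\{x\in V:(c_1+\dots+c_j)x=x\}$ and $\delta_j$ is the Jordan determinant of $V^{(j)}$. A partition is $\mathbf m=(m_1\ge\dots\ge m_r)\in\mathbb{Z}_{\ge0}^r$; write $|\mathbf m|=\sum_jm_j$, and $\mathbf k\subset\mathbf m$ if $k_j\le m_j$ for all $j$. For a partition $\mathbf m$ put $$\Delta_{\mathbf m}(x)=\Delta_r(x)^{m_r}\prod_{j=1}^{r-1}\Delta_j(x)^{m_j-m_{j+1}},\qquad \Phi_{\mathbf m}(x)=\int_K\Delta_{\mathbf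 m}(kx)\,dk$$ ($dk$ the normalized Haar measure), let $d_{\mathbf m}$ be the dimension of the span of the functions $x\mapsto\Delta_{\mathbf m}(gx)$, $g\in G$, and define the generalized binomial coefficients by $$\Phi_{\mathbf m}(e+x)=\sum_{|\mathbf k|\le|\mathbf m|}\binom{\mathbf m}{\mathbf k}\Phi_{\mathbf k}(x),$$ with $\binom{\mathbf m}{\mathbf k}=0$ if $|\mathbf k|>|\mathbf m|$. For $s\in\mathbb{C}$ put $(s)_{\mathbf m}=\prod_{j=1}^r\bigl(s-\tfrac d2(j-1)\bigr)_{m_j}$, where $(t)_k=t(t+1)\cdots(t+k-1)$. The multivariate Meixner, Charlier and Krawtchouk polynomials are $$M_{\mathbf m}(\mathbf x;\alpha,c)=\sum_{\mathbf k\subset\mathbf m}\frac1{d_{\mathbf k}}\frac{(n/r)_{\mathbf k}}{(\alpha)_{\mathbf k}}\binom{\mathbf m}{\mathbf k}\binom{\mathbf x}{\mathbf k}\Bigl(1-\frac1c\Bigr)^{|\mathbf k|},$$ $$C_{\mathbf m}(\mathbf x;a)=\sum_{\mathbf k\subset\mathbf m}\frac1{d_{\mathbf k}}\Bigl(\frac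 nr\Bigr)_{\mathbf k}\binom{\mathbf m}{\mathbf k}\binom{\mathbf x}{\mathbf k}\Bigl(-\frac1a\Bigr)^{|\mathbf k|},$$ $$K_{\mathbf m}(\mathbf x;p,N)=\sum_{\mathbf k\subset\mathbf m}\frac1{d_{\mathbf k}}\frac{(n/r)_{\mathbf k}}{(-N)_{\mathbf k}}\binom{\mathbf m}{\mathbf k}\binom{\mathbf x}{\mathbf k}\Bigl(\frac1p\Bigr)^{|\mathbf k|}\qquad(m_1\le N).$$ Then for all partitions $\mathbf m,\mathbf x$: 1. for all $p\in\mathbb{C}\setminus\{0,1\}$ and $N\in\mathbb{Z}_{\ge0}$ with $m_1\le N$, $$M_{\mathbf m}\Bigl(\mathbf x;-N,\frac p{p-1}\Bigr)=K_{\mathbf m}(\mathbf x;p,N);$$ 2. for all $a\in\mathbb{C}\setminus\{0\}$, as $|\alpha|\to\infty$ in $\mathbb{C}$, $$\lim_{\alpha\to\infty}M_{\mathbf m}\Bigl(\mathbf x;\alpha,\frac a{a+\alpha}\Bigr)=C_{\mathbf m}(\mathbf x;a);$$ 3. for all $a\in\mathbb{C}\setminus\{0\}$, as $N\to\infty$ through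 the integers, $$\lim_{N\to\infty}K_{\mathbf m}\Bigl(\mathbf x;\frac aN,N\Bigr)=C_{\mathbf m}(\mathbf x;a).$$ -/

import Mathlib

open Filter Topology MeasureTheory
open scoped InnerProductSpace Pointwise

/-- A Euclidean Jordan algebra: a real commutative bilinear product with unit on an inner product
space, satisfying the Jordan identity, for which the inner product is associative. -/
class EuclideanJordanAlgebra (V : Type*) [NormedAddCommGroup V] [InnerProductSpace ℝ V] extends
    CommMagma V, One V, IsCommJordan V where
  jmul_add : ∀ x y z : V, x * (y + z) = x * y + x * z
  jmul_smul : ∀ (t : ℝ) (x y : V), x * (t • y) = t • (x * y)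
  jone_mul : ∀ x : V, 1 * x = x
  inner_jmul : ∀ x y z : V, ⟪x * y, z⟫_ℝ = ⟪y, x * z⟫_ℝ

noncomputable section

namespace JordanMDOP

section Algebra

variable (V : Type*) [NormedAddCommGroup V] [InnerProductSpace ℝ V] [EuclideanJordanAlgebra V]

/-- `V` is simple: it is nonzero and its only ideals are `0` and `V`. -/
structure IsSimple : Prop where
  nontrivial : Nontrivial V
  eq_bot_or_top : ∀ I : Submodule ℝ V, (∀ x : V, ∀ y ∈ I, x * y ∈ I) → I = ⊥ ∨ I = ⊤

variable {V}

/-- The multiplication operator `L(x) : y ↦ x * y`. -/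
def mulOp (x : V) : V →ₗ[ℝ] V where
  toFun y := x * y
  map_add' := EuclideanJordanAlgebra.jmul_add x
  map_smul' t y := EuclideanJordanAlgebra.jmul_smul t x y

/-- A primitive idempotent: nonzero and not the sum of two nonzero idempotents. -/
structure IsPrimitiveIdempotent (c : V) : Prop where
  idem : c * c = c
  ne_zero : c ≠ 0
  primitive : ∀ a b : V, a * a = a → b * b = b → c = a + b → a = 0 ∨ b = 0

/-- `c 0, …, c (j-1)` are mutually orthogonal primitive idempotents with sum `u`. -/
structure IsFrameOf {j : ℕ} (u : V) (c : Fin j → V) : Prop where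
  primitive : ∀ i, IsPrimitiveIdempotent (c i)
  orthogonal : ∀ i k, i ≠ k → c i * c k = 0
  sum_eq : ∑ i, c i = u

/-- A Jordan frame: a complete system of orthogonal primitive idempotents.
The number `r` of its elements is the rank of `V`. -/
def IsJordanFrame {r : ℕ} (c : Fin r → V) : Prop := IsFrameOf (1 : V) c

/-- The Peirce space `{x | c_j x = x / 2 and c_k x = x / 2}`. -/
def peirceSpace {r : ℕ} (c : Fin r → V) (j k : Fin r) : Submodule ℝ V :=
  LinearMap.ker (mulOp (c j) - (1 / 2 : ℝ) • LinearMap.id) ⊓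
    LinearMap.ker (mulOp (c k) - (1 / 2 : ℝ) • LinearMap.id)

/-- The multiplicity `d`, the common dimension of the off-diagonal Peirce spaces of a simple
Euclidean Jordan algebra. In rank one there are no such spaces, and no formula below
depends on the value. -/
def multiplicity {r : ℕ} (c : Fin r → V) : ℕ :=
  if h : 1 < r then Module.finrank ℝ (peirceSpace c ⟨0, by omega⟩ ⟨1, h⟩) else 0

/-- The partial sum `e_j = c_1 + … + c_j`. -/
def partialUnit {r : ℕ} (c : Fin r → V) (j : ℕ) : V :=
  ∑ i : Fin r with i.val < j, c i

/-- The subalgebra `V^(j) = {x | e_j x = x}`, with unit `e_j`. -/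
def subAlg {r : ℕ} (c : Fin r → V) (j : ℕ) : Submodule ℝ V :=
  LinearMap.ker (mulOp (partialUnit c j) - LinearMap.id)

/-- The Jordan determinant (Koecher norm) of the subalgebra of rank `j` with unit `u`: the product
of the eigenvalues in a spectral decomposition `x = ∑ λ_i c_i`, where the `c_i` are orthogonal
primitive idempotents with sum `u`. By the spectral theorem a decomposition exists for each `x` in
the subalgebra, and the product does not depend on it. -/
def koecherNorm (j : ℕ) (u x : V) : ℝ :=
  Classical.epsilon fun t : ℝ => ∃ (c : Fin j → V) (ev : Fin j → ℝ),
    IsFrameOf u c ∧ x = ∑ i, ev i • c i ∧ t = ∏ i, ev i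

variable [FiniteDimensional ℝ V]

/-- The principal minor `Δ_j(x) = δ_j(P_j x)`, with `P_j` the orthogonal projection to `V^(j)`. -/
def principalMinor {r : ℕ} (c : Fin r → V) (j : ℕ) (x : V) : ℝ :=
  koecherNorm j (partialUnit c j) ((subAlg c j).starProjection x)

/-- The entry `m_{j+1}` of a vector of length `r` (indices from `0`), with `0` after the end. -/
def nextPart {r : ℕ} (m : Fin r → ℕ) (j : Fin r) : ℕ :=
  if h : j.val + 1 < r then m ⟨j.val + 1, h⟩ else 0

/-- The power function `Δ_m(x) = Δ_1(x)^(m_1 - m_2) ⋯ Δ_{r-1}(x)^(m_{r-1} - m_r) Δ_r(x)^(m_r)`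
of a partition `m`. -/
def powerFn {r : ℕ} (c : Fin r → V) (m : Fin r → ℕ) (x : V) : ℝ :=
  ∏ j : Fin r, principalMinor c (j.val + 1) x ^ (m j - nextPart m j)

end Algebra

section Groups

variable (V : Type*) [NormedAddCommGroup V] [InnerProductSpace ℝ V] [EuclideanJordanAlgebra V]

/-- The symmetric cone of `V`: the interior of the set of squares. -/
def symmetricCone : Set V := interior {y : V | ∃ x : V, y = x * x}

/-- `G(Ω)`, the group of all `g ∈ GL(V)` with `g Ω = Ω`. -/
def coneAut : Subgroup (V →L[ℝ] V)ˣ := MulAction.stabilizer (V →L[ℝ] V)ˣ (symmetricCone V)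

/-- `Aut(V)`, the group of all `g ∈ GL(V)` with `g (x y) = (g x) (g y)`. -/
def jordanAut : Subgroup (V →L[ℝ] V)ˣ where
  carrier := {g | ∀ x y : V, g • (x * y) = (g • x) * (g • y)}
  one_mem' := fun x y => by simp only [one_smul]
  mul_mem' := fun {g h} hg hh x y => by rw [mul_smul, hh, hg, ← mul_smul, ← mul_smul]
  inv_mem' := fun {g} hg x y => by
    rw [inv_smul_eq_iff, hg, smul_inv_smul, smul_inv_smul]

/-- `G`, the identity component of `G(Ω)`. -/
abbrev groupG : Subgroup (coneAut V) := Subgroup.connectedComponentOfOne (coneAut V)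

/-- `K`, the identity component of `Aut(V)`. -/
abbrev groupK : Subgroup (jordanAut V) := Subgroup.connectedComponentOfOne (jordanAut V)

theorem isClosed_jordanAut [FiniteDimensional ℝ V] :
    IsClosed (jordanAut V : Set (V →L[ℝ] V)ˣ) := by
  have hL : ∀ x : V, Continuous fun y : V => x * y := fun x =>
    (mulOp x).continuous_of_finiteDimensional
  have hmul : Continuous fun q : V × V => q.1 * q.2 := by
    let B : V →ₗ[ℝ] V →ₗ[ℝ] V := LinearMap.mk₂ ℝ (fun x y : V => x * y)
      (fun x y z => by
        rw [mul_comm, EuclideanJordanAlgebra.jmul_add, mul_comm z x, mul_comm z y])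
      (fun t x y => by rw [mul_comm, EuclideanJordanAlgebra.jmul_smul, mul_comm y x])
      (fun x y z => EuclideanJordanAlgebra.jmul_add x y z)
      (fun t x y => EuclideanJordanAlgebra.jmul_smul t x y)
    let B' : V →ₗ[ℝ] V →L[ℝ] V :=
      (LinearMap.toContinuousLinearMap : (V →ₗ[ℝ] V) ≃ₗ[ℝ] (V →L[ℝ] V)).toLinearMap ∘ₗ B
    have hB : Continuous B' := B'.continuous_of_finiteDimensional
    exact (hB.comp continuous_fst).clm_apply continuous_snd
  have hev : ∀ x : V, Continuous fun g : (V →L[ℝ] V)ˣ => g • x := fun x =>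
    (Units.continuous_val (M := V →L[ℝ] V)).clm_apply continuous_const
  have : (jordanAut V : Set (V →L[ℝ] V)ˣ) =
      ⋂ (x : V) (y : V), {g | g • (x * y) = (g • x) * (g • y)} := by
    ext g
    simp only [Set.mem_iInter]
    exact Iff.rfl
  rw [this]
  exact isClosed_iInter fun x => isClosed_iInter fun y =>
    isClosed_eq (hev _) (hmul.comp ((hev x).prodMk (hev y)))

instance locallyCompactSpace_groupK [FiniteDimensional ℝ V] :
    LocallyCompactSpace (groupK V) := by
  have : CompleteSpace V := FiniteDimensional.complete ℝ V
  have : ProperSpace (V →L[ℝ] V) := FiniteDimensional.proper ℝ _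
  have : LocallyCompactSpace (V →L[ℝ] V)ˣ :=
    (Units.isOpenEmbedding_val (R := V →L[ℝ] V)).locallyCompactSpace
  have : LocallyCompactSpace (jordanAut V) :=
    (isClosed_jordanAut V).isClosedEmbedding_subtypeVal.locallyCompactSpace
  have h : IsClosed (groupK V : Set (jordanAut V)) := isClosed_connectedComponent
  exact h.isClosedEmbedding_subtypeVal.locallyCompactSpace

end Groups

section Polynomials

variable {V : Type*} [NormedAddCommGroup V] [InnerProductSpace ℝ V] [EuclideanJordanAlgebra V]
  [FiniteDimensional ℝ V] {r : ℕ} (c : Fin r → V)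

/-- The spherical polynomial `Φ_m(x) = ∫_K Δ_m(k x) dk`, the mean of `Δ_m(k x)` with respect to
Haar measure on the compact group `K`. -/
def sphericalPoly (m : Fin r → ℕ) (x : V) : ℝ :=
  letI : MeasurableSpace (groupK V) := borel (groupK V)
  haveI : BorelSpace (groupK V) := ⟨rfl⟩
  ⨍ k : groupK V, powerFn c m (k • x) ∂(Measure.haar : Measure (groupK V))

/-- The dimension `d_m` of the irreducible `G`-module `𝒫_m` of polynomial functions on `V`,
spanned by the translates `x ↦ Δ_m(g x)`, `g ∈ G`. -/
def dimP (m : Fin r → ℕ) : ℕ :=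
  Module.finrank ℝ (Submodule.span ℝ
    (Set.range fun (g : groupG V) (x : V) => powerFn c m (g • x)))

open Classical in
/-- The partitions of length `r` contained in `m`. -/
def partitionsIn (m : Fin r → ℕ) : Finset (Fin r → ℕ) := {k ∈ Finset.Iic m | Antitone k}

open Classical in
/-- The partitions `k` of length `r` with `|k| ≤ w`. -/
def partitionsOfWeightLE (r w : ℕ) : Finset (Fin r → ℕ) :=
  {k ∈ Finset.Iic (fun _ => w) | Antitone k ∧ ∑ j, k j ≤ w}

/-- The generalized binomial coefficients `binom m k`, the coefficients in the expansion
`Φ_m(e + x) = ∑_{|k| ≤ |m|} binom m k Φ_k(x)`. They exist and are unique since the `Φ_k` form a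
basis of the `K`-invariant polynomials, those with `|k| ≤ w` of the ones of degree at most `w`. -/
def binom (m : Fin r → ℕ) : (Fin r → ℕ) → ℝ :=
  Classical.epsilon fun b : (Fin r → ℕ) → ℝ =>
    (∀ k, k ∉ partitionsOfWeightLE r (∑ j, m j) → b k = 0) ∧
    ∀ x : V, sphericalPoly c m (1 + x) =
      ∑ k ∈ partitionsOfWeightLE r (∑ j, m j), b k * sphericalPoly c k x

/-- The generalized shifted factorial `(s)_m = ∏_j (s - (d/2)(j - 1))_{m_j}`, `j = 1, …, r`
(here `j` starts at `0`). -/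
def shiftedFactorial (s : ℂ) (m : Fin r → ℕ) : ℂ :=
  ∏ j : Fin r, (ascPochhammer ℂ (m j)).eval (s - (multiplicity c : ℂ) / 2 * (j.val : ℂ))

/-- `n / r` with `n = dim V`. -/
def dimOverRank : ℂ := (Module.finrank ℝ V : ℂ) / (r : ℂ)

/-- The multivariate Meixner polynomial `M_m(x; α, q)`. -/
def meixner (m x : Fin r → ℕ) (α q : ℂ) : ℂ :=
  ∑ k ∈ partitionsIn m, 1 / (dimP c k : ℂ) *
    (shiftedFactorial c (dimOverRank (V := V) (r := r)) k / shiftedFactorial c α k) *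
    (binom c m k : ℂ) * (binom c x k : ℂ) * (1 - 1 / q) ^ (∑ j, k j)

/-- The multivariate Charlier polynomial `C_m(x; a)`. -/
def charlier (m x : Fin r → ℕ) (a : ℂ) : ℂ :=
  ∑ k ∈ partitionsIn m, 1 / (dimP c k : ℂ) *
    shiftedFactorial c (dimOverRank (V := V) (r := r)) k *
    (binom c m k : ℂ) * (binom c x k : ℂ) * (-1 / a) ^ (∑ j, k j)

/-- The multivariate Krawtchouk polynomial `K_m(x; p, N)` (for `m` contained in `(N, …, N)`). -/
def krawtchouk (m x : Fin r → ℕ) (p : ℂ) (N : ℕ) : ℂ :=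
  ∑ k ∈ partitionsIn m, 1 / (dimP c k : ℂ) *
    (shiftedFactorial c (dimOverRank (V := V) (r := r)) k / shiftedFactorial c (-(N : ℂ)) k) *
    (binom c m k : ℂ) * (binom c x k : ℂ) * (1 / p) ^ (∑ j, k j)

end Polynomials

end JordanMDOP

end

/-! All three families are sums over the same finite set of partitions, and their terms share the
constants $1/d_{\mathbf k}$, $(n/r)_{\mathbf k}$ and the two binomials. So everything is termwise,
and only the power and the parameter factorial matter. The substitutions turn the base of the power
into $1/p$, $-\alpha/a$ and $N/a$ respectively. The first gives Krawtchouk exactly; the third is the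
second at $\alpha=-N$. Both limits then rest on $\alpha^{|\mathbf k|}/(\alpha)_{\mathbf k}\to1$,
true because $(\alpha)_{\mathbf k}$ is monic of degree $|\mathbf k|$ in $\alpha$. -/

/-- `α ^ k / (α - b)_k → 1` as `|α| → ∞`. -/
theorem tendsto_pow_div_ascPochhammer (b : ℂ) (k : ℕ) :
    Tendsto (fun α : ℂ => α ^ k / (ascPochhammer ℂ k).eval (α - b))
      (Bornology.cobounded ℂ) (𝓝 1) := by
  have hlin (t : ℂ) : Tendsto (fun α : ℂ => α / (α - t)) (Bornology.cobounded ℂ) (𝓝 1) := by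
    have h : Tendsto (fun α : ℂ => (1 - t * α⁻¹)⁻¹) (Bornology.cobounded ℂ) (𝓝 1) := by
      simpa using ((tendsto_inv₀_cobounded (α := ℂ)).const_mul t).const_sub 1 |>.inv₀ (by simp)
    refine h.congr' ?_
    filter_upwards [Bornology.eventually_ne_cobounded (0 : ℂ)] with α hα
    rw [show 1 - t * α⁻¹ = (α - t) / α by field_simp, inv_div]
  induction k with
  | zero => simp
  | succ k ih =>
    -- The new last factor of $(\alpha-b)_{k+1}$ is $\alpha-b+k=\alpha-(b-k)$.
    have h := ih.mul (hlin (b - k))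
    rw [mul_one] at h
    refine h.congr fun α => ?_
    rw [ascPochhammer_succ_eval, pow_succ, div_mul_div_comm, sub_sub_eq_add_sub, add_sub_right_comm]

namespace JordanMDOP

variable {V : Type*} [NormedAddCommGroup V] [InnerProductSpace ℝ V] [EuclideanJordanAlgebra V]
  {r : ℕ}

/-- `α ^ |k| / (α)_k → 1` as `|α| → ∞`. -/
theorem tendsto_pow_div_shiftedFactorial (c : Fin r → V) (k : Fin r → ℕ) :
    Tendsto (fun α : ℂ => α ^ (∑ j, k j) / shiftedFactorial c α k)
      (Bornology.cobounded ℂ) (𝓝 1) := by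
  have h := tendsto_finsetProd (Finset.univ : Finset (Fin r)) fun j _ =>
    tendsto_pow_div_ascPochhammer ((multiplicity c : ℂ) / 2 * (j.val : ℂ)) (k j)
  simpa only [Finset.prod_const_one, Finset.prod_div_distrib, Finset.prod_pow_eq_pow_sum,
    shiftedFactorial] using h

/-- The term of index `k` in the limit from Meixner or Krawtchouk to Charlier polynomials. -/
theorem tendsto_limit_term (c : Fin r → V) (k : Fin r → ℕ) (A s B C a : ℂ) :
    Tendsto (fun α : ℂ => A * (s / shiftedFactorial c α k) * B * C * (-α / a) ^ (∑ j, k j))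
      (Bornology.cobounded ℂ) (𝓝 (A * s * B * C * (-1 / a) ^ (∑ j, k j))) := by
  have h := (tendsto_pow_div_shiftedFactorial c k).const_mul
    (A * s * B * C * (-1 / a) ^ (∑ j, k j))
  rw [mul_one] at h
  refine h.congr fun α => ?_
  -- The term is exactly its limit times $\alpha^{|\mathbf k|}/(\alpha)_{\mathbf k}$, even at zeros
  -- of $(\alpha)_{\mathbf k}$, where both sides are `0`.
  rw [show -α / a = -1 / a * α by ring, mul_pow]
  ring

/-- Makes the Krawtchouk limit a restriction of the complex limit to the sequence $\alpha=-N$. -/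
theorem tendsto_neg_natCast_cobounded :
    Tendsto (fun N : ℕ => -(N : ℂ)) atTop (Bornology.cobounded ℂ) :=
  tendsto_neg_cobounded.comp (tendsto_natCast_atTop_cobounded (α := ℂ))

end JordanMDOP

theorem mainTheorem9 {V : Type*} [NormedAddCommGroup V] [InnerProductSpace ℝ V]
    [EuclideanJordanAlgebra V] [FiniteDimensional ℝ V] (hV : JordanMDOP.IsSimple V)
    {r : ℕ} (c : Fin r → V) (hc : JordanMDOP.IsJordanFrame c)
    (m x : Fin r → ℕ) (hm : Antitone m) (hx : Antitone x) :
    (∀ (p : ℂ) (N : ℕ), p ≠ 0 → p ≠ 1 → (∀ j, m j ≤ N) →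
      JordanMDOP.meixner c m x (-(N : ℂ)) (p / (p - 1)) = JordanMDOP.krawtchouk c m x p N) ∧
    (∀ a : ℂ, a ≠ 0 →
      Tendsto (fun α : ℂ => JordanMDOP.meixner c m x α (a / (a + α)))
        (Bornology.cobounded ℂ) (𝓝 (JordanMDOP.charlier c m x a))) ∧
    (∀ a : ℂ, a ≠ 0 →
      Tendsto (fun N : ℕ => JordanMDOP.krawtchouk c m x (a / (N : ℂ)) N)
        atTop (𝓝 (JordanMDOP.charlier c m x a))) := by
  refine ⟨fun p N hp hp1 _ => ?_, fun a ha => ?_, fun a ha => ?_⟩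
  · have h : 1 - 1 / (p / (p - 1)) = 1 / p := by
      have : p - 1 ≠ 0 := sub_ne_zero.mpr hp1
      field_simp
      ring
    simp only [JordanMDOP.meixner, JordanMDOP.krawtchouk, h]
  -- Also true at $\alpha=-a$: there division by zero makes both sides `1`.
  · have h (α : ℂ) : 1 - 1 / (a / (a + α)) = -α / a := by
      rw [one_div_div]
      field_simp
      ring
    simp only [JordanMDOP.meixner, JordanMDOP.charlier, h]
    exact tendsto_finsetSum _ fun k _ => JordanMDOP.tendsto_limit_term c k _ _ _ _ a
  -- The double negation exhibits $N/a$ as $-\alpha/a$ with $\alpha=-N$; at $N=0$ both sides are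
  -- `0`.
  · have h (N : ℕ) : 1 / (a / (N : ℂ)) = - -(N : ℂ) / a := by
      rw [one_div_div, neg_neg]
    simp only [JordanMDOP.krawtchouk, JordanMDOP.charlier, h]
    exact tendsto_finsetSum _ fun k _ =>
      (JordanMDOP.tendsto_limit_term c k _ _ _ _ a).comp JordanMDOP.tendsto_neg_natCast_cobounded
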